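/- A metric space $X$ has asymptotic dimension $\operatorname{asdim} X\le n$ if for every $d>0$ there are a number $R$ and $n+1$ families $\mathcal U_0,\dots,\mathcal U_n$ of subsets of $X$ that together cover $X$, such that for each $i$ every member of $\mathcal U_i$ has diameter at most $R$, and any two points in two different members of $\mathcal U_i$ are at distance greater than $d$; $\operatorname{asdim} X\in\{0,1,2,\dots,\infty\}$ is the least such $n$ ($\infty$ if there is none). The asymptotic dimension of a finitely generated group is that of the group with any left invariant metric all of whose balls are finite (for example, a word metric); it does not depend on this metric. The asymptotic dimension of an arbitrary group $G$ is $$\operatorname{asdim} G=\sup\{\operatorname{asdim} F \mid F\subset G \text{ a finitely generated subgroup}\}.$$ Theorem. Let $A$ be an abelian group (not necessarily countable). Then $$\operatorname{asdim} A=\dim_{\mathbf Q}(A\otimes_{\mathbf Z}\mathbf Q),$$ where both sides take values in $\{0,1,2,\dots,\infty\}$, an infinite-dimensional vector space having dimension $\infty$. -/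

import Mathlib

open scoped TensorProduct

/-- A family of subsets of a metric space is `R`-bounded if all its members have diameter at most
`R`. -/
def IsBoundedFamily {X : Type*} [MetricSpace X] (R : ℝ) (𝒰 : Set (Set X)) : Prop :=
  ∀ U ∈ 𝒰, ∀ x ∈ U, ∀ y ∈ U, dist x y ≤ R

/-- A family of subsets of a metric space is `d`-disjoint if points of two different members are
at distance greater than `d`. -/
def IsDisjointFamily {X : Type*} [MetricSpace X] (d : ℝ) (𝒰 : Set (Set X)) : Prop :=
  ∀ U ∈ 𝒰, ∀ V ∈ 𝒰, U ≠ V → ∀ x ∈ U, ∀ y ∈ V, d < dist x y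

/-- The metric space `X` has asymptotic dimension at most `n`: for every `d > 0` there are `R` and
`n + 1` families of subsets, each `d`-disjoint and `R`-bounded, which together cover `X`. -/
def AsdimLE (X : Type*) [MetricSpace X] (n : ℕ) : Prop :=
  ∀ d : ℝ, 0 < d → ∃ (R : ℝ) (𝒰 : Fin (n + 1) → Set (Set X)),
    (∀ i, IsDisjointFamily d (𝒰 i)) ∧ (∀ i, IsBoundedFamily R (𝒰 i)) ∧
      ∀ x : X, ∃ i, ∃ U ∈ 𝒰 i, x ∈ U

/-- The asymptotic dimension of a metric space: the least `n` with `AsdimLE X n`, and `⊤` if there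
is none. -/
noncomputable def asdim (X : Type*) [MetricSpace X] : ℕ∞ :=
  ⨅ (n : ℕ) (_ : AsdimLE X n), (n : ℕ∞)

/-- `m` is a left invariant proper metric on the discrete group `G`. Compact subsets of a discrete
space are the finite ones, so properness means that closed balls are finite (and a metric
with finite balls induces the discrete topology). -/
structure IsLeftInvariantProperMetric (G : Type*) [Group G] (m : MetricSpace G) : Prop where
  dist_mul_left : ∀ g x y : G, m.dist (g * x) (g * y) = m.dist x y
  finite_closedBall : ∀ (x : G) (r : ℝ), {y : G | m.dist x y ≤ r}.Finite

/-- The asymptotic dimension of a countable (for instance finitely generated) discrete group: that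
of any of its left invariant proper metrics. The infimum is over a nonempty
family by `exists_isLeftInvariantProperMetric`, and all its members agree by
`countableGroupAsdim_eq`. -/
noncomputable def countableGroupAsdim (G : Type*) [Group G] : ℕ∞ :=
  ⨅ (m : MetricSpace G) (_ : IsLeftInvariantProperMetric G m), @asdim G m

/-- The asymptotic dimension of an arbitrary group: the supremum of the asymptotic dimensions of
its finitely generated subgroups. -/
noncomputable def groupAsdim (G : Type*) [Group G] : ℕ∞ :=
  ⨆ (F : Subgroup G) (_ : F.FG), countableGroupAsdim F

/-- Coarse invariance for two left invariant proper metrics on the same group. -/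
theorem AsdimLE.of_isLeftInvariantProperMetric {G : Type*} [Group G] {m m' : MetricSpace G}
    (hm : IsLeftInvariantProperMetric G m) (hm' : IsLeftInvariantProperMetric G m') {n : ℕ}
    (h : @AsdimLE G m n) : @AsdimLE G m' n := by
  have key : ∀ {m m' : MetricSpace G}, IsLeftInvariantProperMetric G m →
      IsLeftInvariantProperMetric G m' → ∀ r : ℝ, ∃ s : ℝ, 0 < s ∧
        ∀ x y : G, m.dist x y ≤ r → m'.dist x y ≤ s := by
    intro m m' hm hm' r
    obtain ⟨s, hs⟩ := ((hm.finite_closedBall 1 r).image (fun y => m'.dist 1 y)).bddAbove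
    refine ⟨max s 1, by positivity, fun x y hxy => le_max_of_le_left ?_⟩
    have h1 := hm.dist_mul_left x⁻¹ x y
    have h2 := hm'.dist_mul_left x⁻¹ x y
    rw [inv_mul_cancel] at h1 h2
    rw [← h2]
    exact hs ⟨x⁻¹ * y, by simpa [h1] using hxy, rfl⟩
  intro d _
  obtain ⟨d₁, hd₁, hd⟩ := key hm' hm d
  obtain ⟨R, 𝒰, hdis, hbd, hcov⟩ := h d₁ hd₁
  obtain ⟨R₁, _, hR⟩ := key hm hm' R
  refine ⟨R₁, 𝒰, fun i U hU V hV hUV x hx y hy => ?_,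
    fun i U hU x hx y hy => hR x y (hbd i U hU x hx y hy), hcov⟩
  by_contra hle
  exact absurd (hd x y (not_lt.mp hle)) (not_le.mpr (hdis i U hU V hV hUV x hx y hy))

/-- The asymptotic dimension of a group does not depend on the left invariant proper metric. -/
theorem countableGroupAsdim_eq {G : Type*} [Group G] {m : MetricSpace G}
    (hm : IsLeftInvariantProperMetric G m) : countableGroupAsdim G = @asdim G m := by
  refine le_antisymm (iInf₂_le m hm) (le_iInf₂ fun m' hm' => ?_)
  exact le_iInf₂ fun n hn => iInf₂_le n (hn.of_isLeftInvariantProperMetric hm' hm)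

/-- Every countable group has a left invariant proper metric. -/
theorem exists_isLeftInvariantProperMetric (G : Type*) [Group G] [Countable G] :
    ∃ m : MetricSpace G, IsLeftInvariantProperMetric G m := by
  classical
  obtain ⟨e, he⟩ := exists_injective_nat G
  let w : G → ℕ := fun g => e g + e g⁻¹ + 1
  have hw1 : ∀ g, 1 ≤ w g := fun g => Nat.le_add_left _ _
  have hwi : ∀ g, w g⁻¹ = w g := fun g => by simp only [w, inv_inv]; ring
  have hwf : ∀ k, {g | w g ≤ k}.Finite := fun k =>
    ((Set.finite_Iic k).preimage he.injOn).subset fun g hg => by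
      simp only [Set.mem_preimage, Set.mem_Iic, Set.mem_ofPred_eq, w] at hg ⊢; omega
  let N : G → Set ℕ := fun x => {k | ∃ l : List G, l.prod = x ∧ (l.map w).sum = k}
  let ν : G → ℕ := fun x => sInf (N x)
  have hN : ∀ x, ν x ∈ N x := fun x => Nat.sInf_mem ⟨w x, [x], by simp, by simp⟩
  have hle : ∀ l : List G, ν l.prod ≤ (l.map w).sum := fun l => Nat.sInf_le ⟨l, rfl, rfl⟩
  have hlen : ∀ l : List G, l.length ≤ (l.map w).sum := by
    intro l
    induction l with
    | nil => simp
    | cons a l ih => have := hw1 a; simp only [List.length_cons, List.map_cons, List.sum_cons]; omega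
  have hmem : ∀ l : List G, ∀ a ∈ l, w a ≤ (l.map w).sum := fun l a ha =>
    List.single_le_sum (fun _ _ => Nat.zero_le _) _ (List.mem_map_of_mem ha)
  have h1 : ν 1 = 0 := Nat.le_zero.mp (by simpa using hle [])
  have h0 : ∀ x, ν x = 0 → x = 1 := by
    intro x hx
    obtain ⟨l, hl, hs⟩ := hN x
    have := hlen l
    rw [hs, hx, Nat.le_zero, List.length_eq_zero_iff] at this
    rw [← hl, this, List.prod_nil]
  have hinvle : ∀ x, ν x⁻¹ ≤ ν x := by
    intro x
    obtain ⟨l, hl, hs⟩ := hN x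
    have := hle (l.map (fun g => g⁻¹)).reverse
    rw [← List.prod_inv_reverse, hl] at this
    rw [List.map_reverse, List.sum_reverse, List.map_map,
      show w ∘ (fun g => g⁻¹) = w from funext hwi, hs] at this
    exact this
  have hinv : ∀ x, ν x⁻¹ = ν x := fun x =>
    le_antisymm (hinvle x) (by simpa using hinvle x⁻¹)
  have hmul : ∀ x y, ν (x * y) ≤ ν x + ν y := by
    intro x y
    obtain ⟨l, hl, hs⟩ := hN x
    obtain ⟨l', hl', hs'⟩ := hN y
    have := hle (l ++ l')
    rw [List.prod_append, hl, hl', List.map_append, List.sum_append, hs, hs'] at this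
    exact this
  have hfin : ∀ k : ℕ, {x | ν x ≤ k}.Finite := by
    intro k
    have : Finite {g | w g ≤ k} := hwf k
    refine ((List.finite_length_le {g | w g ≤ k} k).image
      (fun l => (l.map Subtype.val).prod)).subset ?_
    intro x hx
    obtain ⟨l, hl, hs⟩ := hN x
    have hx' : ν x ≤ k := hx
    refine ⟨l.attach.map fun a => ⟨a.1, (hmem l a.1 a.2).trans (hs.le.trans hx')⟩, ?_, ?_⟩
    · simpa using (hlen l).trans (hs.le.trans hx')
    · simp [List.map_map, Function.comp_def, hl]
  refine ⟨{ dist := fun x y => (ν (x⁻¹ * y) : ℝ)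
            dist_self := fun x => by simp [h1]
            dist_comm := fun x y => by rw [← hinv (x⁻¹ * y)]; simp
            dist_triangle := fun x y z => by
              have := hmul (x⁻¹ * y) (y⁻¹ * z)
              rw [show x⁻¹ * y * (y⁻¹ * z) = x⁻¹ * z by group] at this
              exact_mod_cast this
            eq_of_dist_eq_zero := fun {x y} h => by
              have := h0 _ (Nat.cast_eq_zero.mp h)
              exact (inv_mul_eq_one.mp this) }, ?_, ?_⟩
  · intro g x y
    change (ν ((g * x)⁻¹ * (g * y)) : ℝ) = (ν (x⁻¹ * y) : ℝ)
    rw [show (g * x)⁻¹ * (g * y) = x⁻¹ * y by group]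
  · intro x r
    refine ((hfin ⌊r⌋₊).preimage (mul_right_injective x⁻¹).injOn).subset ?_
    intro y hy
    exact Nat.le_floor hy

/-! The coarse covering condition depends only on finite sets of group elements (`CoarseDimLE`), and
pulls back along homomorphisms with finite kernel (`CoarseDimLE.comap`). A finitely generated
subgroup `F` of `A` is `ℤᵏ × finite`, so both inequalities reduce to `ℤᵏ`.

* For `asdim F ≤ k`, project to `ℤᵏ` and use an explicit cover by `k + 1` families of cubes
  (`coarseDimLE_int`). Moreover `k` is at most the rank of `A`, since `ℤᵏ` embeds in `A`.
* Conversely, `k` independent elements of `A` give a finitely generated subgroup isomorphic to `ℤᵏ`,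
  and `ℤᵏ` has no such cover with fewer than `k + 1` families (`CoarseDimLE.le_of_int`). This is the
  Lebesgue covering theorem. It follows from Sperner's lemma for Kuhn's triangulation of a large
  cube (`sum_labelDet_eq_one`), proved by counting doors modulo `2`. The count is kept in
  determinants over `ZMod 2`, so that the parity of doors of one simplex is a Laplace expansion.

The rank over `ℤ` agrees with the dimension of `ℚ ⊗ A` because tensoring with `ℚ` is localization
(`rank_rat_tensorProduct`). -/

/-! ### Asymptotic dimension in terms of finite sets -/

/-- A group has coarse dimension at most `n` if, for every finite set `S`, it is covered by `n + 1`
families of subsets such that differences of points in distinct members of one family avoid `S`,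
while differences within a member all lie in one finite set `T`. For a left invariant proper metric
this is `AsdimLE`, with finite sets playing the role of radii. -/
def CoarseDimLE (G : Type*) [Group G] (n : ℕ) : Prop :=
  ∀ S : Set G, S.Finite → ∃ T : Set G, T.Finite ∧ ∃ 𝒰 : Fin (n + 1) → Set (Set G),
    (∀ i, ∀ U ∈ 𝒰 i, ∀ V ∈ 𝒰 i, U ≠ V → ∀ x ∈ U, ∀ y ∈ V, x⁻¹ * y ∉ S) ∧
    (∀ i, ∀ U ∈ 𝒰 i, ∀ x ∈ U, ∀ y ∈ U, x⁻¹ * y ∈ T) ∧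
    ∀ x : G, ∃ i, ∃ U ∈ 𝒰 i, x ∈ U

theorem IsLeftInvariantProperMetric.dist_one {G : Type*} [Group G] {m : MetricSpace G}
    (hm : IsLeftInvariantProperMetric G m) (x y : G) : m.dist 1 (x⁻¹ * y) = m.dist x y := by
  rw [← hm.dist_mul_left x 1 (x⁻¹ * y), mul_one, mul_inv_cancel_left]

theorem IsLeftInvariantProperMetric.asdimLE_iff {G : Type*} [Group G] {m : MetricSpace G}
    (hm : IsLeftInvariantProperMetric G m) {n : ℕ} : @AsdimLE G m n ↔ CoarseDimLE G n := by
  have bound : ∀ S : Set G, S.Finite → ∃ d : ℝ, 0 < d ∧ ∀ s ∈ S, m.dist 1 s ≤ d := by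
    intro S hS
    obtain ⟨d, hd⟩ := (hS.image (fun s => m.dist 1 s)).bddAbove
    exact ⟨max d 1, by positivity, fun s hs => le_max_of_le_left (hd ⟨s, hs, rfl⟩)⟩
  constructor
  · intro h S hS
    obtain ⟨d, hd, hdS⟩ := bound S hS
    obtain ⟨R, 𝒰, hdis, hbd, hcov⟩ := h d hd
    refine ⟨_, hm.finite_closedBall 1 R, 𝒰, ?_, ?_, hcov⟩
    · intro i U hU V hV hUV x hx y hy hxy
      have := hdS _ hxy
      rw [hm.dist_one] at this
      exact absurd this (not_le.mpr (hdis i U hU V hV hUV x hx y hy))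
    · intro i U hU x hx y hy
      change m.dist 1 (x⁻¹ * y) ≤ R
      rw [hm.dist_one]
      exact hbd i U hU x hx y hy
  · intro h d _
    obtain ⟨T, hT, 𝒰, hdis, hbd, hcov⟩ := h _ (hm.finite_closedBall 1 d)
    obtain ⟨R, _, hR⟩ := bound T hT
    refine ⟨R, 𝒰, ?_, ?_, hcov⟩
    · intro i U hU V hV hUV x hx y hy
      by_contra hle
      refine hdis i U hU V hV hUV x hx y hy ?_
      change m.dist 1 (x⁻¹ * y) ≤ d
      rw [hm.dist_one]
      exact not_lt.mp hle
    · intro i U hU x hx y hy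
      have := hR _ (hbd i U hU x hx y hy)
      rwa [hm.dist_one] at this

theorem CoarseDimLE.countableGroupAsdim_le {G : Type*} [Group G] [Countable G] {n : ℕ}
    (h : CoarseDimLE G n) : countableGroupAsdim G ≤ n := by
  obtain ⟨m, hm⟩ := exists_isLeftInvariantProperMetric G
  rw [countableGroupAsdim_eq hm]
  exact iInf₂_le n (hm.asdimLE_iff.mpr h)

theorem le_countableGroupAsdim {G : Type*} [Group G] {n : ℕ}
    (h : ∀ k, CoarseDimLE G k → n ≤ k) : (n : ℕ∞) ≤ countableGroupAsdim G :=
  le_iInf₂ fun _ hm => le_iInf₂ fun k hk => Nat.cast_le.mpr (h k (hm.asdimLE_iff.mp hk))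

/-- Coarse dimension bounds pull back along homomorphisms with finite kernel: take preimages of the
covering families. -/
theorem CoarseDimLE.comap {G H : Type*} [Group G] [Group H] {n : ℕ} (h : CoarseDimLE H n)
    (f : G →* H) (hf : (f.ker : Set G).Finite) : CoarseDimLE G n := by
  intro S hS
  obtain ⟨T, hT, 𝒰, hdis, hbd, hcov⟩ := h (f '' S) (hS.image f)
  refine ⟨f ⁻¹' T, hT.preimage' fun b _ => ?_, fun i => (f ⁻¹' ·) '' 𝒰 i, ?_, ?_, ?_⟩
  · by_cases hb : ∃ a, f a = b
    · obtain ⟨a, rfl⟩ := hb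
      refine (hf.image (a * ·)).subset fun x hx => ⟨a⁻¹ * x, ?_, by simp⟩
      have hx' : f x = f a := hx
      simp [MonoidHom.mem_ker, hx']
    · convert Set.finite_empty
      ext x
      exact iff_of_false (fun hx => hb ⟨x, hx⟩) id
  · rintro i _ ⟨U, hU, rfl⟩ _ ⟨V, hV, rfl⟩ hUV x hx y hy hxy
    exact hdis i U hU V hV (fun e => hUV (by rw [e])) (f x) hx (f y) hy ⟨_, hxy, by simp⟩
  · rintro i _ ⟨U, hU, rfl⟩ x hx y hy
    simpa using hbd i U hU (f x) hx (f y) hy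
  · intro x
    obtain ⟨i, U, hU, hx⟩ := hcov (f x)
    exact ⟨i, _, ⟨U, hU, rfl⟩, hx⟩

/-! ### Sperner's lemma for Kuhn's triangulation -/

/-- The `k`-th vertex of the simplex of Kuhn's triangulation with lowest vertex `v` in which the
coordinates are raised by `1` in order of decreasing `τ`. Vertices are numbered downwards:
`k = 0` is `v + (1, …, 1)`, and `k = n` is `v`. With this numbering, a facet in the face `x 0 = 0`
has `τ 0 = 0` and is opposite to vertex `0`. -/
def kuhnVertex {n : ℕ} (v : Fin n → ℕ) (τ : Equiv.Perm (Fin n)) (k : ℕ) : Fin n → ℕ :=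
  fun i => v i + if k ≤ τ i then 1 else 0

/-- The determinant modulo `2` of the incidence matrix between vertices `p` and the values
`c` of a labelling `ℓ`. For injective `c` it is `1` if all labels `c i` occur among the `p j`, and
`0` otherwise. -/
def labelDet {X Y : Type*} [DecidableEq Y] {m : ℕ} (ℓ : X → Y) (c : Fin m → Y) (p : Fin m → X) :
    ZMod 2 :=
  Matrix.det (Matrix.of fun i j => if ℓ (p j) = c i then 1 else 0)

theorem labelDet_eq_zero {X Y : Type*} [DecidableEq Y] {m : ℕ} {ℓ : X → Y} {c : Fin m → Y}
    {p : Fin m → X} (i : Fin m) (h : ∀ j, ℓ (p j) ≠ c i) : labelDet ℓ c p = 0 :=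
  Matrix.det_eq_zero_of_row_eq_zero i fun j => by simp [h j]

/-- A simplex carries all labels `0, …, m` if and only if it has an odd number of facets carrying
the labels `1, …, m`. This is a Laplace expansion, after replacing the row of the label `0` by the
sum of all rows, which is constantly `1`. -/
theorem labelDet_eq_sum {X : Type*} {m : ℕ} (ℓ : X → Fin (m + 1)) (p : Fin (m + 1) → X) :
    labelDet ℓ id p = ∑ k : Fin (m + 1), labelDet ℓ Fin.succ fun j => p (k.succAbove j) := by
  set M : Matrix (Fin (m + 1)) (Fin (m + 1)) (ZMod 2) :=
    Matrix.of fun i j => if ℓ (p j) = i then 1 else 0 with hM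
  have h : M.det = (M.updateRow 0 (∑ k, M k)).det := by
    have := Matrix.det_updateRow_sum M 0 (fun _ => 1)
    simpa using this.symm
  change M.det = _
  rw [h, Matrix.det_succ_row_zero]
  refine Finset.sum_congr rfl fun k _ => ?_
  have h1 : (M.updateRow 0 (∑ k, M k)) 0 k = 1 := by
    rw [Matrix.updateRow_self]
    exact (Finset.sum_apply k _ M).trans (by simp [hM])
  have h2 : ((-1 : ZMod 2)) = 1 := by decide
  rw [h1, h2, one_pow, one_mul, one_mul, labelDet]
  congr 1

/-- Facets opposite to an inner vertex cancel in pairs: exchanging two consecutive directions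
changes only the vertex between them. -/
theorem sum_facet_inner {Y : Type*} [DecidableEq Y] {n : ℕ} (ℓ : (Fin (n + 1) → ℕ) → Y)
    (c : Fin (n + 1) → Y) (v : Fin (n + 1) → ℕ) (k : Fin n) :
    ∑ τ : Equiv.Perm (Fin (n + 1)),
      labelDet ℓ c (fun j => kuhnVertex v τ (k.succ.castSucc.succAbove j : Fin (n + 2))) = 0 := by
  refine Finset.sum_involution (fun τ _ => τ.trans (Equiv.swap k.castSucc k.succ)) ?_ ?_ ?_ ?_
  · intro τ _
    suffices h : ∀ j : Fin (n + 1),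
        kuhnVertex v (τ.trans (Equiv.swap k.castSucc k.succ))
            (k.succ.castSucc.succAbove j : Fin (n + 2))
          = kuhnVertex v τ (k.succ.castSucc.succAbove j : Fin (n + 2)) by
      simp only [h]
      exact CharTwo.add_self_eq_zero _
    intro j
    have hj : ((k.succ.castSucc.succAbove j : Fin (n + 2)) : ℕ) ≠ k + 1 := by
      intro h
      exact Fin.succAbove_ne k.succ.castSucc j (Fin.ext (by simpa using h))
    generalize ((k.succ.castSucc.succAbove j : Fin (n + 2)) : ℕ) = a at hj
    have hswap : ∀ b : Fin (n + 1), a ≤ (Equiv.swap k.castSucc k.succ b : ℕ) ↔ a ≤ (b : ℕ) := by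
      intro b
      rcases eq_or_ne b k.castSucc with rfl | h
      · rw [Equiv.swap_apply_left, Fin.val_succ, Fin.val_castSucc]
        omega
      rcases eq_or_ne b k.succ with rfl | h'
      · rw [Equiv.swap_apply_right, Fin.val_succ, Fin.val_castSucc]
        omega
      · rw [Equiv.swap_apply_of_ne_of_ne h h']
    ext i
    simp only [kuhnVertex, Equiv.trans_apply, hswap]
  · intro τ _ _ h
    have := Equiv.congr_fun h (τ.symm k.castSucc)
    simp [Fin.ext_iff] at this
  · intro τ _
    exact Finset.mem_univ _
  · intro τ _
    ext i
    simp

/-- The facets opposite to the top and the bottom vertex cancel between cubes neighbouring in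
the direction `a = τ⁻¹ 0` that is raised last. What remains are facets in the two faces of the box
transverse to `a`. In the far face the last label is forbidden, in the face `x a = 0` the label `a`
is; so only the face `x 0 = 0` can have facets with the labels `1, …, n + 1`. -/
theorem sum_facet_outer {n N : ℕ} (ℓ : (Fin (n + 1) → ℕ) → Fin (n + 2))
    (h0 : ∀ x i, x i = 0 → ℓ x ≠ i.castSucc) (hN : ∀ x i, x i = N + 1 → ℓ x ≠ Fin.last _)
    (τ : Equiv.Perm (Fin (n + 1))) (a : Fin (n + 1)) (ha : τ a = 0) :
    ∑ v : Fin (n + 1) → Fin (N + 1),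
      (labelDet ℓ Fin.succ (fun j : Fin (n + 1) => kuhnVertex (fun i => v i) τ (j + 1)) +
       labelDet ℓ Fin.succ (fun j : Fin (n + 1) =>
        kuhnVertex (fun i => v i) (τ.trans (finRotate (n + 1)).symm) j)) =
    if a = 0 then ∑ w : Fin n → Fin (N + 1), labelDet ℓ Fin.succ (fun j : Fin (n + 1) =>
      kuhnVertex (Fin.cons 0 fun i => (w i : ℕ)) τ (j + 1)) else 0 := by
  set f : (Fin n → Fin (N + 1)) → Fin (N + 1) → ZMod 2 := fun w x =>
    labelDet ℓ Fin.succ (fun j : Fin (n + 1) =>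
      kuhnVertex (fun i => (a.insertNth x w : Fin (n + 1) → Fin (N + 1)) i) τ (j + 1)) with hf
  set g : (Fin n → Fin (N + 1)) → Fin (N + 1) → ZMod 2 := fun w x =>
    labelDet ℓ Fin.succ (fun j : Fin (n + 1) =>
      kuhnVertex (fun i => (a.insertNth x w : Fin (n + 1) → Fin (N + 1)) i)
        (τ.trans (finRotate (n + 1)).symm) j) with hg
  have hrot : (finRotate (n + 1)).symm 0 = Fin.last n := by
    rw [Equiv.symm_apply_eq, finRotate_last]
  -- Lowering the cube by one step in direction `a` turns its top facet into the bottom one.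
  have hfg : ∀ w (x : Fin N), f w x.succ = g w x.castSucc := by
    intro w x
    simp only [hf, hg]
    congr 1
    funext j i
    have hj := j.is_le
    rcases eq_or_ne i a with rfl | hi
    · simp [kuhnVertex, ha, hrot, hj]
    · obtain ⟨i, rfl⟩ := Fin.exists_succAbove_eq hi
      have hne : τ (a.succAbove i) ≠ 0 := fun h => hi (τ.injective (h.trans ha.symm))
      obtain ⟨b, hb⟩ := Fin.exists_succ_eq.mpr hne
      have hrb : (finRotate (n + 1)).symm b.succ = b.castSucc := by
        rw [Equiv.symm_apply_eq, finRotate_apply, Fin.coeSucc_eq_succ]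
      simp [kuhnVertex, ← hb, hrb]
  have hlast : ∀ w, g w (Fin.last N) = 0 := by
    intro w
    refine labelDet_eq_zero (Fin.last n) fun j => ?_
    rw [Fin.succ_last]
    refine hN _ a ?_
    simp [kuhnVertex, ha, hrot, j.is_le]
  have hzero : a ≠ 0 → ∀ w, f w 0 = 0 := by
    intro hne w
    obtain ⟨b, rfl⟩ := Fin.exists_succ_eq.mpr hne
    refine labelDet_eq_zero b.castSucc fun j => ?_
    rw [Fin.succ_castSucc]
    refine h0 _ b.succ ?_
    simp [kuhnVertex, ha]
  have key : ∀ w, ∑ x, (f w x + g w x) = f w 0 := by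
    intro w
    rw [Finset.sum_add_distrib, Fin.sum_univ_succ, Fin.sum_univ_castSucc (g w), hlast, add_zero]
    simp only [hfg, add_assoc, CharTwo.add_self_eq_zero, add_zero]
  rw [← (Fin.insertNthEquiv (fun _ => Fin (N + 1)) a).sum_comp, Fintype.sum_prod_type_right]
  calc _ = ∑ w, ∑ x, (f w x + g w x) := rfl
    _ = ∑ w, f w 0 := Finset.sum_congr rfl fun w _ => key w
    _ = _ := by
      split_ifs with h
      · subst h
        refine Finset.sum_congr rfl fun w _ => ?_
        simp only [hf]
        congr 1
        funext j
        congr 1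
        funext i
        refine Fin.cases ?_ (fun i => ?_) i <;> simp
      · exact Finset.sum_eq_zero fun w _ => hzero h w

/-- **Sperner's lemma** for Kuhn's triangulation of the cube `[0, N + 1]ⁿ`, modulo `2`. The cube is
viewed as a simplex whose facets are the `n` faces `x i = 0` and the union of the faces
`x i = N + 1`. -/
theorem sum_labelDet_eq_one {N : ℕ} : ∀ {n : ℕ} (ℓ : (Fin n → ℕ) → Fin (n + 1)),
    (∀ x i, x i = 0 → ℓ x ≠ i.castSucc) → (∀ x i, x i = N + 1 → ℓ x ≠ Fin.last _) →
    ∑ τ : Equiv.Perm (Fin n), ∑ v : Fin n → Fin (N + 1),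
      labelDet ℓ id (fun j => kuhnVertex (fun i => v i) τ j) = 1
  | 0, ℓ, _, _ => by
    simp [labelDet, eq_iff_true_of_subsingleton]
  | n + 1, ℓ, h0, hN => by
    have step : ∀ (τ : Equiv.Perm (Fin (n + 1))) (v : Fin (n + 1) → Fin (N + 1)),
        labelDet ℓ id (fun j => kuhnVertex (fun i => v i) τ j) =
        labelDet ℓ Fin.succ (fun j : Fin (n + 1) => kuhnVertex (fun i => v i) τ (j + 1)) +
        labelDet ℓ Fin.succ (fun j : Fin (n + 1) => kuhnVertex (fun i => v i) τ j) +
        ∑ k : Fin n, labelDet ℓ Fin.succ (fun j =>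
          kuhnVertex (fun i => v i) τ (k.succ.castSucc.succAbove j : Fin (n + 2))) := by
      intro τ v
      rw [labelDet_eq_sum, Fin.sum_univ_succ, Fin.sum_univ_castSucc]
      simp only [Fin.zero_succAbove, Fin.succ_last, Fin.succAbove_last, Fin.val_succ,
        Fin.val_castSucc, Fin.succ_castSucc]
      ring
    -- The three kinds of facets are opposite to the top, the bottom, and the inner vertices.
    have inner : ∑ τ : Equiv.Perm (Fin (n + 1)), ∑ v : Fin (n + 1) → Fin (N + 1),
        ∑ k : Fin n, labelDet ℓ Fin.succ (fun j =>
          kuhnVertex (fun i => v i) τ (k.succ.castSucc.succAbove j : Fin (n + 2))) = 0 := by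
      rw [Finset.sum_comm]
      refine Finset.sum_eq_zero fun v _ => ?_
      rw [Finset.sum_comm]
      exact Finset.sum_eq_zero fun k _ => sum_facet_inner ℓ Fin.succ _ k
    have rot : ∑ τ : Equiv.Perm (Fin (n + 1)), ∑ v : Fin (n + 1) → Fin (N + 1),
          labelDet ℓ Fin.succ (fun j : Fin (n + 1) => kuhnVertex (fun i => v i) τ j) =
        ∑ τ : Equiv.Perm (Fin (n + 1)), ∑ v : Fin (n + 1) → Fin (N + 1),
          labelDet ℓ Fin.succ (fun j : Fin (n + 1) =>
            kuhnVertex (fun i => v i) (τ.trans (finRotate (n + 1)).symm) j) :=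
      (Equiv.sum_comp (Equiv.mulLeft (finRotate (n + 1)).symm :
        Equiv.Perm (Fin (n + 1)) ≃ Equiv.Perm (Fin (n + 1))) _).symm
    simp only [step, Finset.sum_add_distrib]
    rw [inner, add_zero, rot, ← Finset.sum_add_distrib]
    simp only [← Finset.sum_add_distrib]
    rw [Finset.sum_congr rfl fun τ _ =>
      sum_facet_outer ℓ h0 hN τ (τ.symm 0) (τ.apply_symm_apply 0)]
    -- Only orders with `τ 0 = 0` are left; they are the orders of the remaining coordinates.
    rw [← Equiv.Perm.decomposeFin.symm.sum_comp, Fintype.sum_prod_type, Fin.sum_univ_succ,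
      add_eq_left.mpr, ← sum_labelDet_eq_one (N := N)
        (fun x => (0 : Fin (n + 1)).predAbove (ℓ (Fin.cons 0 x)))]
    · refine Finset.sum_congr rfl fun τ _ => ?_
      rw [if_pos (by rw [Equiv.symm_apply_eq]; simp)]
      refine Finset.sum_congr rfl fun w _ => ?_
      have hv : ∀ j : ℕ, kuhnVertex (Fin.cons 0 fun i => (w i : ℕ))
          (Equiv.Perm.decomposeFin.symm (0, τ)) (j + 1) =
          Fin.cons 0 (kuhnVertex (fun i => w i) τ j) := by
        intro j
        funext i
        refine Fin.cases ?_ (fun i => ?_) i <;> simp [kuhnVertex]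
      simp only [hv, labelDet]
      congr 1
      ext i j
      have := h0 (Fin.cons 0 (kuhnVertex (fun i => w i) τ j)) 0 rfl
      obtain ⟨c, hc⟩ := Fin.exists_succ_eq.mpr this
      simp [← hc]
    · intro x i hx h
      obtain ⟨c, hc⟩ := Fin.exists_succ_eq.mpr (h0 (Fin.cons 0 x) 0 rfl)
      refine h0 (Fin.cons 0 x) i.succ (by simpa using hx) ?_
      simp only [← hc, Fin.predAbove_zero_succ] at h
      rw [← hc, h, Fin.succ_castSucc]
    · intro x i hx h
      obtain ⟨c, hc⟩ := Fin.exists_succ_eq.mpr (h0 (Fin.cons 0 x) 0 rfl)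
      refine hN (Fin.cons 0 x) i.succ (by simpa using hx) ?_
      simp only [← hc, Fin.predAbove_zero_succ] at h
      rw [← hc, h, Fin.succ_last]
    · refine Finset.sum_eq_zero fun p _ => Finset.sum_eq_zero fun τ _ => if_neg ?_
      rw [Equiv.symm_apply_eq]
      simp [Fin.ext_iff]

/-! ### The coarse dimension of `ℤⁿ` -/

/-- **Sperner's lemma** on the orthant `ℕⁿ`: some simplex of Kuhn's triangulation carries all
labels. In particular there are points with all labels at mutual sup-distance at most `1`. -/
theorem exists_all_labels {n N : ℕ} (ℓ : (Fin n → ℕ) → Fin (n + 1))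
    (h0 : ∀ x i, x i = 0 → ℓ x ≠ i.castSucc) (hN : ∀ x i, x i = N + 1 → ℓ x ≠ Fin.last _) :
    ∃ p : Fin (n + 1) → Fin n → ℕ, (∀ c, ℓ (p c) = c) ∧
      ∀ a b i, p a i ≤ p b i + 1 := by
  obtain ⟨τ, -, h⟩ := Finset.exists_ne_zero_of_sum_ne_zero
    ((sum_labelDet_eq_one ℓ h0 hN).trans_ne one_ne_zero)
  obtain ⟨v, -, h⟩ := Finset.exists_ne_zero_of_sum_ne_zero h
  have hsurj : ∀ c, ∃ j : Fin (n + 1), ℓ (kuhnVertex (fun i => v i) τ j) = c := by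
    intro c
    by_contra! hc
    exact h (labelDet_eq_zero c hc)
  choose j hj using hsurj
  refine ⟨fun c => kuhnVertex (fun i => v i) τ (j c), hj, fun a b i => ?_⟩
  simp only [kuhnVertex]
  split_ifs <;> omega

/-- The Lebesgue covering theorem for `ℤⁿ`: fewer than `n + 1` families do not suffice. Label a
point `x` by a coordinate hyperplane that the member `U x` of the cover containing it misses, or,
if it meets all of them, by the label of the far faces, which it then misses by boundedness. Two of
the `n + 1` points given by Sperner's lemma lie in members of the same family; being neighbours,
they lie in the same member, so they cannot have different labels. -/
theorem CoarseDimLE.le_of_int {n m : ℕ} (h : CoarseDimLE (Multiplicative (Fin n → ℤ)) m) :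
    n ≤ m := by
  classical
  by_contra! hmn
  obtain ⟨T, hT, 𝒰, hdis, hbd, hcov⟩ := h (Multiplicative.toAdd ⁻¹' Set.Icc (-1) 1)
    ((Set.finite_Icc _ _).preimage Multiplicative.toAdd.injective.injOn)
  obtain ⟨N, hN⟩ : ∃ N : ℕ, ∀ t ∈ T, ∀ i, (Multiplicative.toAdd t) i ≤ N := by
    obtain ⟨b, hb⟩ := (hT.image Multiplicative.toAdd).bddAbove
    refine ⟨∑ i, (b i).toNat, fun t ht i => (hb ⟨t, ht, rfl⟩ i).trans ?_⟩
    have := Finset.single_le_sum (f := fun i => (b i).toNat) (fun _ _ => Nat.zero_le _)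
      (Finset.mem_univ i)
    exact (Int.self_le_toNat _).trans (by exact_mod_cast this)
  let emb : (Fin n → ℕ) → Multiplicative (Fin n → ℤ) := fun x =>
    Multiplicative.ofAdd fun i => (x i : ℤ)
  choose κ U hU hxU using fun x => hcov (emb x)
  -- A member of the cover has sup-diameter at most `N`.
  let meets : Set (Multiplicative (Fin n → ℤ)) → Fin n → Prop := fun V i =>
    ∃ y ∈ V, (Multiplicative.toAdd y) i = 0
  let g : Set (Multiplicative (Fin n → ℤ)) → Fin (n + 1) := fun V =>
    if hV : ∃ i, ¬ meets V i then hV.choose.castSucc else Fin.last n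
  have h0 : ∀ x i, x i = 0 → g (U x) ≠ i.castSucc := by
    intro x i hx hg
    by_cases hV : ∃ i, ¬ meets (U x) i
    · simp only [g, dif_pos hV] at hg
      have hi := Fin.castSucc_injective _ hg
      refine hV.choose_spec ?_
      rw [hi]
      exact ⟨emb x, hxU x, by simp [emb, hx]⟩
    · simp only [g, dif_neg hV] at hg
      exact (Fin.castSucc_lt_last i).ne hg.symm
  have hfar : ∀ x i, x i = N + 1 → g (U x) ≠ Fin.last n := by
    intro x i hx hg
    by_cases hV : ∃ i, ¬ meets (U x) i
    · simp only [g, dif_pos hV] at hg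
      exact (Fin.castSucc_lt_last _).ne hg
    · push Not at hV
      obtain ⟨y, hy, hyi⟩ := hV i
      have := hN _ (hbd _ _ (hU x) y hy _ (hxU x)) i
      simp [emb, hyi, hx] at this
  obtain ⟨p, hp, hadj⟩ := exists_all_labels (fun x => g (U x)) h0 hfar
  obtain ⟨a, b, hab, hκ⟩ := Fintype.exists_ne_map_eq_of_card_lt (fun c => κ (p c))
    (by simpa using hmn)
  have hUab : U (p a) = U (p b) := by
    by_contra hne
    refine hdis (κ (p a)) _ (hU _) _ ?_ hne _ (hxU _) _ (hxU _) ?_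
    · have : κ (p a) = κ (p b) := hκ
      rw [this]
      exact hU _
    · refine ⟨fun i => ?_, fun i => ?_⟩
      · have := hadj a b i
        simp [emb]
        omega
      · have := hadj b a i
        simp [emb]
        omega
  exact hab (by rw [← hp a, ← hp b, hUab])

/-- The strip colouring: for each of `n + 1` colours `i`, a coordinate is bad for the colour `i`
if it lies in `[i s, (i + 1) s)` modulo `(n + 1) s`. Each of the `n` coordinates of a point is bad
for exactly one colour, so some colour is good for all of them. The points good for `i` split into
cubes of side `n s` separated by strips of width `s`. -/
theorem coarseDimLE_int (n : ℕ) : CoarseDimLE (Multiplicative (Fin n → ℤ)) n := by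
  intro S hS
  obtain ⟨s, hs0, hs⟩ : ∃ s : ℤ, 0 < s ∧ ∀ t ∈ S, ∀ i, |(Multiplicative.toAdd t) i| ≤ s := by
    obtain ⟨b, hb⟩ := (hS.image fun t => |Multiplicative.toAdd t|).bddAbove
    refine ⟨∑ i, |b i| + 1, by positivity, fun t ht i => (hb ⟨t, ht, rfl⟩ i).trans ?_⟩
    have := Finset.single_le_sum (f := fun i => |b i|) (fun _ _ => abs_nonneg _)
      (Finset.mem_univ i)
    have := le_abs_self (b i)
    linarith
  set L : ℤ := (n + 1) * s with hL
  have hL0 : 0 < L := by positivity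
  refine ⟨Multiplicative.toAdd ⁻¹' Set.Icc (fun _ => -L) (fun _ => L),
    (Set.finite_Icc _ _).preimage Multiplicative.toAdd.injective.injOn,
    fun i => Set.range fun c : Fin n → ℤ => {x | ∀ j,
      L * c j + i * s + s ≤ (Multiplicative.toAdd x) j ∧
      (Multiplicative.toAdd x) j < L * c j + i * s + L}, ?_, ?_, ?_⟩
  · rintro i _ ⟨c, rfl⟩ _ ⟨c', rfl⟩ hne x hx y hy hxy
    refine hne ?_
    suffices h : c = c' by rw [h]
    funext j
    have h1 := hx j
    have h2 := hy j
    have h3 := abs_le.mp (hs _ hxy j)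
    simp only [toAdd_mul, toAdd_inv, Pi.add_apply, Pi.neg_apply] at h3
    apply le_antisymm
    · by_contra! hlt
      have := mul_le_mul_of_nonneg_left (Int.add_one_le_iff.mpr hlt) hL0.le
      rw [mul_add, mul_one] at this
      linarith
    · by_contra! hlt
      have := mul_le_mul_of_nonneg_left (Int.add_one_le_iff.mpr hlt) hL0.le
      rw [mul_add, mul_one] at this
      linarith
  · rintro i _ ⟨c, rfl⟩ x hx y hy
    refine ⟨fun j => ?_, fun j => ?_⟩ <;>
    · have h1 := hx j
      have h2 := hy j
      simp only [toAdd_mul, toAdd_inv, Pi.add_apply, Pi.neg_apply]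
      linarith
  · intro x
    have hbad : ∀ j, ∃ i : Fin (n + 1), (i : ℤ) = (Multiplicative.toAdd x) j % L / s := by
      intro j
      have h1 : 0 ≤ (Multiplicative.toAdd x) j % L / s :=
        Int.ediv_nonneg (Int.emod_nonneg _ hL0.ne') hs0.le
      have h2 : (Multiplicative.toAdd x) j % L / s < n + 1 :=
        Int.ediv_lt_of_lt_mul hs0 (Int.emod_lt_of_pos _ hL0)
      exact ⟨⟨((Multiplicative.toAdd x) j % L / s).toNat, by omega⟩, by simp [h1]⟩
    choose bad hbad using hbad
    obtain ⟨i, hi⟩ : ∃ i, ∀ j, bad j ≠ i := by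
      by_contra! h
      have := Fintype.card_le_of_surjective bad h
      simp at this
    refine ⟨i, _, ⟨fun j => ((Multiplicative.toAdd x) j - i * s) / L, rfl⟩, fun j => ?_⟩
    set z := (Multiplicative.toAdd x) j with hz
    have h1 := Int.mul_ediv_add_emod (z - i * s) L
    have h2 := Int.emod_nonneg (z - i * s) hL0.ne'
    have h3 := Int.emod_lt_of_pos (z - i * s) hL0
    refine ⟨?_, by linarith⟩
    by_contra! hlt
    -- Otherwise `z - i s` is less than `s` modulo `L`, and `i` is the bad colour of `z`.
    refine hi j (Fin.ext ?_)
    set q := (z - i * s) / L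
    have hi' : ((i : ℕ) : ℤ) ≤ n := by exact_mod_cast i.is_le
    have hi0 : (0 : ℤ) ≤ ((i : ℕ) : ℤ) := by positivity
    have hr : z % L = i * s + (z - i * s) % L := by
      have hb1 : 0 ≤ i * s + (z - i * s) % L := by positivity
      have hb2 : i * s + (z - i * s) % L < L := by nlinarith
      rw [← Int.emod_eq_of_lt hb1 hb2]
      apply Int.ModEq.symm
      apply (Int.modEq_iff_dvd).mpr
      exact ⟨q, by linarith⟩
    have : (bad j : ℤ) = i := by
      rw [hbad j, ← hz, hr, add_comm, Int.add_mul_ediv_right _ _ hs0.ne',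
        Int.ediv_eq_zero_of_lt h2 (by linarith), zero_add]
    exact_mod_cast this

/-! ### Abelian groups -/

/-- Tensoring with `ℚ` is localization at the nonzero integers, so it preserves the rank. -/
theorem rank_rat_tensorProduct (A : Type*) [AddCommGroup A] :
    Module.rank ℚ (ℚ ⊗[ℤ] A) = Module.rank ℤ A := by
  have : IsLocalizedModule (nonZeroDivisors ℤ) (TensorProduct.mk ℤ ℚ A 1) :=
    (isLocalizedModule_iff_isBaseChange _ ℚ _).mpr (TensorProduct.isBaseChange ℤ A ℚ)
  rw [← IsLocalizedModule.rank_eq (nonZeroDivisors ℤ) le_rfl (TensorProduct.mk ℤ ℚ A 1)]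
  exact IsLocalization.rank_eq ℚ (nonZeroDivisors ℤ) le_rfl

/-- The asymptotic dimension of a finitely generated subgroup `F ≅ ℤᵏ × finite` is at most `k`,
which is at most the rank because `ℤᵏ` embeds in `A`. -/
theorem countableGroupAsdim_le_rank {A : Type*} [AddCommGroup A] (F : Subgroup (Multiplicative A))
    (hF : F.FG) : countableGroupAsdim F ≤ Cardinal.toENat (Module.rank ℤ A) := by
  have : Group.FG F := (Group.fg_iff_subgroup_fg F).mpr hF
  obtain ⟨k, ι, _, p, hp, e, ⟨φ⟩⟩ := AddCommGroup.equiv_free_prod_directSum_zmod (Additive F)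
  have : ∀ i, NeZero (p i ^ e i) := fun i => ⟨pow_ne_zero _ (hp i).ne_zero⟩
  have : Finite (DirectSum ι fun i => ZMod (p i ^ e i)) := by
    classical
    exact .of_equiv _ (DirectSum.addEquivProd fun i => ZMod (p i ^ e i)).symm.toEquiv
  have : Countable F := by
    have : Countable (Additive F) := φ.injective.countable
    exact this
  have hk : (k : Cardinal) ≤ Module.rank ℤ A := by
    rw [Module.le_rank_iff_exists_linearMap]
    let f : (Fin k →₀ ℤ) →+ A := (AddMonoidHom.toMultiplicativeLeft.symm F.subtype).comp
      (φ.symm.toAddMonoidHom.comp (AddMonoidHom.inl _ _))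
    have hf : Function.Injective f := fun x y h =>
      congrArg Prod.fst (φ.symm.injective (Subtype.val_injective h))
    exact ⟨f.toIntLinearMap.comp (Finsupp.linearEquivFunOnFinite ℤ ℤ (Fin k)).symm.toLinearMap,
      hf.comp (Finsupp.linearEquivFunOnFinite ℤ ℤ (Fin k)).symm.injective⟩
  refine le_trans ?_ (Cardinal.natCast_le_toENat.mpr hk)
  let f : Additive F →+ (Fin k → ℤ) :=
    (Finsupp.linearEquivFunOnFinite ℤ ℤ (Fin k)).toAddMonoidHom.comp
      ((AddMonoidHom.fst _ _).comp φ.toAddMonoidHom)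
  refine ((coarseDimLE_int k).comap (AddMonoidHom.toMultiplicativeRight f)
    ?_).countableGroupAsdim_le
  refine (Set.finite_range fun t => (φ.symm (0, t)).toMul).subset fun x hx => ⟨(φ (.ofMul x)).2, ?_⟩
  have h1 : (φ (.ofMul x)).1 = 0 :=
    (Finsupp.linearEquivFunOnFinite ℤ ℤ (Fin k)).map_eq_zero_iff.mp hx
  rw [← h1]
  exact congrArg Additive.toMul (φ.symm_apply_apply (.ofMul x))

/-- `k` independent elements of `A` generate a subgroup containing `ℤᵏ`, whose asymptotic dimension
is therefore at least `k`. -/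
theorem le_groupAsdim {A : Type*} [AddCommGroup A] {k : ℕ}
    (hk : (k : Cardinal) ≤ Module.rank ℤ A) : (k : ℕ∞) ≤ groupAsdim (Multiplicative A) := by
  obtain ⟨f, hf⟩ := Module.le_rank_iff_exists_linearMap.mp hk
  let g : Multiplicative (Fin k → ℤ) →* Multiplicative A :=
    AddMonoidHom.toMultiplicative f.toAddMonoidHom
  have hg : Function.Injective g := hf
  have hfg : g.range.FG := by
    rw [← Group.fg_iff_subgroup_fg]
    exact Group.fg_range g
  refine le_trans (le_countableGroupAsdim fun m hm => ?_)
    (le_iSup₂ (f := fun (F : Subgroup (Multiplicative A)) (_ : F.FG) => countableGroupAsdim F)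
      g.range hfg)
  refine (hm.comap g.rangeRestrict ?_).le_of_int
  rw [(MonoidHom.ker_eq_bot_iff _).mpr (MonoidHom.rangeRestrict_injective_iff.mpr hg)]
  exact Set.finite_singleton 1

theorem theorem3p2 (A : Type*) [AddCommGroup A] :
    groupAsdim (Multiplicative A) = Cardinal.toENat (Module.rank ℚ (ℚ ⊗[ℤ] A)) := by
  rw [rank_rat_tensorProduct]
  refine le_antisymm (iSup₂_le countableGroupAsdim_le_rank) ?_
  exact ENat.forall_natCast_le_iff_le.mp fun k hk =>
    le_groupAsdim (Cardinal.natCast_le_toENat.mp hk)
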